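/- Let $1\le r<n$ and let $A\in\mathbf R^{n\times n}$ be symmetric with eigenvalues $\lambda_1\ge\dots\ge\lambda_n$ and $\lambda_r>\lambda_{r+1}$. Write $A=V_1\Lambda_1V_1^T+V_2\Lambda_2V_2^T$ with $\Lambda_1=\mathrm{diag}(\lambda_1,\dots,\lambda_r)$, $\Lambda_2=\mathrm{diag}(\lambda_{r+1},\dots,\lambda_n)$, $V_1\in\mathbf R^{n\times r}$, $V_2\in\mathbf R^{n\times(n-r)}$ and $[V_1\mid V_2]$ orthogonal. Let $E\in\mathbf R^{n\times n}$ be symmetric, $\widehat A=A+E$, and $B_{i,j}=V_i^TBV_j$ for $B\in\mathbf R^{n\times n}$ and $i,j\in\{1,2\}$. Let $\|\cdot\|_2$ be the spectral norm, $\|\cdot\|_F$ the Frobenius norm, and $\|\cdot\|_{2,\infty}$ the maximal Euclidean norm of a row. Put $$\mathsf{sep}_2(\Lambda_1,\Lambda_2)=\inf\{\|Z\Lambda_1-\Lambda_2Z\|_2: Z\in\mathbf R^{(n-r)\times r},\ \|Z\|_2=1\},$$ $$\mathsf{sep}_{(2,\infty),V_2}(\Lambda_1,V_2\Lambda_2V_2^T)=\inf\{\|Z\Lambda_1-V_2\Lambda_2V_2^TZ\|_{2,\infty}: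 Z=V_2X,\ X\in\mathbf R^{(n-r)\times r},\ \|Z\|_{2,\infty}=1\},$$ $$\mathsf{gap}=\min\{\mathsf{sep}_2(\Lambda_1,\Lambda_2),\ \mathsf{sep}_{(2,\infty),V_2}(\Lambda_1,V_2\Lambda_2V_2^T)\}.$$ On $\mathbf R^{(n-r)\times r}$ define $S_{\widehat A}(Z)=Z\widehat A_{1,1}-\widehat A_{2,2}Z$ and $F(X)=-\widehat A_{2,1}+X\widehat A_{1,1}-\widehat A_{2,2}X+X\widehat A_{1,2}X$. Suppose $\|E\|_2\le \mathsf{gap}/5$. Then $S_{\widehat A}$ is bijective, and the sequence $X_0=0$, $X_{t+1}=X_t-S_{\widehat A}^{-1}(F(X_t))$ converges to a matrix $\widehat X$ with $F(\widehat X)=0$ and $\|\widehat X\|_2\le 4\|E_{2,1}\|_2/\mathsf{sep}_2(\Lambda_1,\Lambda_2)$. Moreover, put $\widehat Y=V_2\widehat X$, let $\widehat V_1\in\mathbf R^{n\times r}$ be any matrix with orthonormal columns whose range is the invariant subspace of $\widehat A$ associated with its $r$ algebraically largest eigenvalues, and let $\widetilde U$ be any solution of $\min\{\|\widehat V_1U-V_1\|_F: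 U\in\mathbf R^{r\times r}\text{ orthogonal}\}$. Then $$\|\widehat V_1\widetilde U-V_1\|_{2,\infty}\le 8\|V_1\|_{2,\infty}\left(\frac{\|E_{2,1}\|_2}{\mathsf{sep}_2(\Lambda_1,\Lambda_2)}\right)^2+2\,\frac{\|V_2E_{2,1}\|_{2,\infty}+\|V_2E_{2,2}V_2^T\widehat Y\|_{2,\infty}}{\mathsf{gap}}.$$ -/

import Mathlib

open scoped Matrix Topology

namespace RowPert

section Norms

open scoped Matrix.Norms.L2Operator

/-- The spectral norm `‖B‖₂`: the operator norm of `B` between Euclidean spaces. -/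
noncomputable def norm2 {m l : ℕ} (B : Matrix (Fin m) (Fin l) ℝ) : ℝ := ‖B‖

end Norms

/-- The Frobenius norm. -/
noncomputable def normF {m l : ℕ} (B : Matrix (Fin m) (Fin l) ℝ) : ℝ :=
  Real.sqrt (∑ i, ∑ j, B i j ^ 2)

/-- The two-to-infinity norm: the maximal Euclidean norm of a row. -/
noncomputable def normTwoInf {m l : ℕ} (B : Matrix (Fin m) (Fin l) ℝ) : ℝ :=
  ⨆ i, Real.sqrt (∑ j, B i j ^ 2)

/-- The separation `inf {N (Z B - C Z) : N Z = 1}` of `B` and `C` in the norm `N`. -/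
noncomputable def sep {m l : ℕ} (N : Matrix (Fin m) (Fin l) ℝ → ℝ)
    (B : Matrix (Fin l) (Fin l) ℝ) (C : Matrix (Fin m) (Fin m) ℝ) : ℝ :=
  sInf {c | ∃ Z : Matrix (Fin m) (Fin l) ℝ, N Z = 1 ∧ c = N (Z * B - C * Z)}

/-- The separation restricted to the matrices `Z` all of whose columns lie in the range of `W`,
that is, to the matrices of the form `W X`. -/
noncomputable def sepOn {m l k : ℕ} (N : Matrix (Fin m) (Fin l) ℝ → ℝ)
    (W : Matrix (Fin m) (Fin k) ℝ)
    (B : Matrix (Fin l) (Fin l) ℝ) (C : Matrix (Fin m) (Fin m) ℝ) : ℝ :=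
  sInf {c | ∃ Z : Matrix (Fin m) (Fin l) ℝ,
    (∃ X : Matrix (Fin k) (Fin l) ℝ, Z = W * X) ∧ N Z = 1 ∧ c = N (Z * B - C * Z)}

/-- `A = V₁ diag(μ₁) V₁ᵀ + V₂ diag(μ₂) V₂ᵀ` is an eigendecomposition in which `[V₁ | V₂]` is an
orthogonal matrix and the eigenvalues, those of `μ₁` followed by those of `μ₂`, are listed in
descending order. -/
structure IsOrderedEigendecomp {n r : ℕ} (A : Matrix (Fin n) (Fin n) ℝ)
    (V₁ : Matrix (Fin n) (Fin r) ℝ) (V₂ : Matrix (Fin n) (Fin (n - r)) ℝ)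
    (μ₁ : Fin r → ℝ) (μ₂ : Fin (n - r) → ℝ) : Prop where
  orth₁ : V₁ᵀ * V₁ = 1
  orth₂ : V₂ᵀ * V₂ = 1
  orth₁₂ : V₁ᵀ * V₂ = 0
  eq : A = V₁ * Matrix.diagonal μ₁ * V₁ᵀ + V₂ * Matrix.diagonal μ₂ * V₂ᵀ
  antitone₁ : Antitone μ₁
  antitone₂ : Antitone μ₂
  le : ∀ i j, μ₂ j ≤ μ₁ i

/-- `W` has orthonormal columns, and its range is an `r`-dimensional invariant subspace of the
symmetric matrix `M` that belongs to its `r` algebraically largest eigenvalues. -/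
def IsDominantBasis {n r : ℕ} (M : Matrix (Fin n) (Fin n) ℝ)
    (W : Matrix (Fin n) (Fin r) ℝ) : Prop :=
  Wᵀ * W = 1 ∧
    ∃ (W₁ : Matrix (Fin n) (Fin r) ℝ) (W₂ : Matrix (Fin n) (Fin (n - r)) ℝ)
      (ν₁ : Fin r → ℝ) (ν₂ : Fin (n - r) → ℝ),
      IsOrderedEigendecomp M W₁ W₂ ν₁ ν₂ ∧
        LinearMap.range W.mulVecLin = LinearMap.range W₁.mulVecLin

/-- `U` solves the orthogonal Procrustes problem `min {‖W U - V‖_F : U orthogonal}`. -/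
def IsProcrustesSolution {n r : ℕ} (W V : Matrix (Fin n) (Fin r) ℝ)
    (U : Matrix (Fin r) (Fin r) ℝ) : Prop :=
  U ∈ Matrix.orthogonalGroup (Fin r) ℝ ∧
    ∀ U' ∈ Matrix.orthogonalGroup (Fin r) ℝ, normF (W * U - V) ≤ normF (W * U' - V)

/-- The block `Vᵀ B W` of `B`; with `V = V_i` and `W = V_j` this is `B_{i,j}`. -/
def block {n k l : ℕ} (V : Matrix (Fin n) (Fin k) ℝ) (B : Matrix (Fin n) (Fin n) ℝ)
    (W : Matrix (Fin n) (Fin l) ℝ) : Matrix (Fin k) (Fin l) ℝ :=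
  Vᵀ * B * W

/-- `min {sep₂(Λ₁, Λ₂), sep_{(2,∞),V₂}(Λ₁, V₂ Λ₂ V₂ᵀ)}` with `Λ_i = diag(μ_i)`. -/
noncomputable def gap {n r : ℕ} (V₂ : Matrix (Fin n) (Fin (n - r)) ℝ)
    (μ₁ : Fin r → ℝ) (μ₂ : Fin (n - r) → ℝ) : ℝ :=
  min (sep norm2 (Matrix.diagonal μ₁) (Matrix.diagonal μ₂))
    (sepOn normTwoInf V₂ (Matrix.diagonal μ₁) (V₂ * Matrix.diagonal μ₂ * V₂ᵀ))

/-- The Sylvester operator `S_B : Z ↦ Z B₁₁ - B₂₂ Z`. -/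
def sylvester {n r : ℕ} (V₁ : Matrix (Fin n) (Fin r) ℝ) (V₂ : Matrix (Fin n) (Fin (n - r)) ℝ)
    (B : Matrix (Fin n) (Fin n) ℝ) (Z : Matrix (Fin (n - r)) (Fin r) ℝ) :
    Matrix (Fin (n - r)) (Fin r) ℝ :=
  Z * block V₁ B V₁ - block V₂ B V₂ * Z

/-- The quadratic map `F : X ↦ -B₂₁ + X B₁₁ - B₂₂ X + X B₁₂ X`. -/
def quadMap {n r : ℕ} (V₁ : Matrix (Fin n) (Fin r) ℝ) (V₂ : Matrix (Fin n) (Fin (n - r)) ℝ)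
    (B : Matrix (Fin n) (Fin n) ℝ) (X : Matrix (Fin (n - r)) (Fin r) ℝ) :
    Matrix (Fin (n - r)) (Fin r) ℝ :=
  -block V₂ B V₁ + X * block V₁ B V₁ - block V₂ B V₂ * X + X * block V₁ B V₂ * X

/-- The iteration `X₀ = 0`, `X_{t+1} = X_t - S_B⁻¹ (F (X_t))`. Here `Function.invFun` is the
inverse of `S_B` as soon as `S_B` is bijective. -/
noncomputable def newtonSeq {n r : ℕ} (V₁ : Matrix (Fin n) (Fin r) ℝ)
    (V₂ : Matrix (Fin n) (Fin (n - r)) ℝ) (B : Matrix (Fin n) (Fin n) ℝ) :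
    ℕ → Matrix (Fin (n - r)) (Fin r) ℝ
  | 0 => 0
  | t + 1 => newtonSeq V₁ V₂ B t -
      Function.invFun (sylvester V₁ V₂ B) (quadMap V₁ V₂ B (newtonSeq V₁ V₂ B t))

end RowPert

open RowPert

/-!
Write `Â = A + E`, `G = V₁ + V₂ X̂`, `H = V₂ - V₁ X̂ᵀ`, `δ = sep₂(Λ₁, Λ₂)` and `γ = ‖E₂₁‖₂`.

The Sylvester operator `S` of `Â` is bounded below by `δ - 2 ‖E‖₂ ≥ 3 δ / 5`, hence bijective, and
the iteration is the fixed point iteration of `X ↦ S⁻¹ (E₂₁ - X E₁₂ X)`. This map is a contraction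
of the ball of radius `2 γ / δ` (`newtonSeq_tendsto`), so `‖X̂‖₂ ≤ 2 γ / δ`.

The equation `F(X̂) = 0` says that the range of `G` is invariant under `Â`: `Â G = G L`, and by
symmetry `Â H = H L₂` on the orthogonal complement. Here `L` and `L₂` are small perturbations of
`Λ₁` and `Λ₂`. Since `δ ≤ λ_r - λ_{r+1}`, their numerical ranges stay apart, which identifies the
range of `G` with the dominant subspace (`IsOrderedEigendecomp.transpose_mul_eq_zero`,
`IsDominantBasis.eq_graph_mul`). No dimension count is needed: rows of `W₂ᵀ G` and `W₁ᵀ H` are left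
eigenvectors of `L` and `L₂`.

At a Procrustes solution `V₁ᵀ V̂₁ U` is positive semidefinite (`IsProcrustesSolution.posSemidef`).
Hence `V̂₁ U = G P` with `P = (1 + X̂ᵀ X̂)^(-1/2)`, and `V̂₁ U - V₁ = V₁ (P - 1) + V₂ X̂ P` with
`‖P‖₂ ≤ 1` and `‖P - 1‖₂ ≤ ‖X̂‖₂²`. The first term gives the quadratic part of the bound. For the
second, `V₂ F(X̂) = 0` is a Sylvester equation for `V₂ X̂`, to which the separation in the
two-to-infinity norm applies (`sepOn_mul_normTwoInf_le`).
-/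

namespace RowPert

/-! ### The spectral norm -/

section SpectralNorm

open scoped Matrix.Norms.L2Operator

variable {m l k : ℕ}

lemma norm2_nonneg (B : Matrix (Fin m) (Fin l) ℝ) : 0 ≤ norm2 B := norm_nonneg B

lemma norm2_eq_zero {B : Matrix (Fin m) (Fin l) ℝ} : norm2 B = 0 ↔ B = 0 := norm_eq_zero

lemma norm2_add_le (B C : Matrix (Fin m) (Fin l) ℝ) : norm2 (B + C) ≤ norm2 B + norm2 C :=
  norm_add_le B C

lemma norm2_sub_le (B C : Matrix (Fin m) (Fin l) ℝ) : norm2 (B - C) ≤ norm2 B + norm2 C :=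
  norm_sub_le B C

lemma norm2_smul (c : ℝ) (B : Matrix (Fin m) (Fin l) ℝ) : norm2 (c • B) = |c| * norm2 B :=
  norm_smul c B

lemma norm2_mul_le (B : Matrix (Fin m) (Fin l) ℝ) (C : Matrix (Fin l) (Fin k) ℝ) :
    norm2 (B * C) ≤ norm2 B * norm2 C :=
  Matrix.l2_opNorm_mul B C

lemma norm2_transpose (B : Matrix (Fin m) (Fin l) ℝ) : norm2 Bᵀ = norm2 B := by
  rw [← Matrix.conjTranspose_eq_transpose_of_trivial]
  exact Matrix.l2_opNorm_conjTranspose B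

lemma norm_toLp_sq (x : Fin l → ℝ) : ‖WithLp.toLp 2 x‖ ^ 2 = x ⬝ᵥ x := by
  rw [EuclideanSpace.norm_sq_eq]
  simp [dotProduct, sq]

lemma dotProduct_self_nonneg' (x : Fin l → ℝ) : 0 ≤ x ⬝ᵥ x := by
  rw [← norm_toLp_sq]; positivity

lemma mulVec_dotProduct_self_le (B : Matrix (Fin m) (Fin l) ℝ) (x : Fin l → ℝ) :
    (B *ᵥ x) ⬝ᵥ (B *ᵥ x) ≤ norm2 B ^ 2 * (x ⬝ᵥ x) := by
  rw [← norm_toLp_sq, ← norm_toLp_sq, ← mul_pow]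
  exact pow_le_pow_left₀ (norm_nonneg _) (Matrix.l2_opNorm_mulVec B (WithLp.toLp 2 x)) 2

lemma norm2_le_of_mulVec {B : Matrix (Fin m) (Fin l) ℝ} {c : ℝ} (hc : 0 ≤ c)
    (h : ∀ x, (B *ᵥ x) ⬝ᵥ (B *ᵥ x) ≤ c ^ 2 * (x ⬝ᵥ x)) : norm2 B ≤ c := by
  unfold norm2
  rw [Matrix.l2_opNorm_def]
  refine ContinuousLinearMap.opNorm_le_bound _ hc fun x => ?_
  have h1 := h x.ofLp
  rw [← norm_toLp_sq, ← norm_toLp_sq, ← mul_pow] at h1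
  exact le_of_sq_le_sq h1 (by positivity)

lemma abs_dotProduct_le (x y : Fin l → ℝ) :
    |x ⬝ᵥ y| ≤ ‖WithLp.toLp 2 x‖ * ‖WithLp.toLp 2 y‖ := by
  have := abs_real_inner_le_norm (WithLp.toLp 2 y) (WithLp.toLp 2 x)
  rw [EuclideanSpace.inner_toLp_toLp] at this
  simpa [mul_comm] using this

lemma abs_dotProduct_mulVec_le (B : Matrix (Fin l) (Fin l) ℝ) (x : Fin l → ℝ) :
    |x ⬝ᵥ (B *ᵥ x)| ≤ norm2 B * (x ⬝ᵥ x) := by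
  have h1 := abs_dotProduct_le x (B *ᵥ x)
  have h2 : ‖WithLp.toLp 2 (B *ᵥ x)‖ ≤ norm2 B * ‖WithLp.toLp 2 x‖ :=
    Matrix.l2_opNorm_mulVec B (WithLp.toLp 2 x)
  rw [← norm_toLp_sq]
  nlinarith [norm_nonneg (WithLp.toLp 2 x)]

lemma abs_entry_le_norm2 (B : Matrix (Fin m) (Fin l) ℝ) (i : Fin m) (j : Fin l) :
    |B i j| ≤ norm2 B := by
  have h := mulVec_dotProduct_self_le B (Pi.single j 1)
  simp only [Matrix.mulVec_single_one, dotProduct_single_one, Pi.single_eq_same, mul_one] at h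
  have h2 : B i j ^ 2 ≤ B.col j ⬝ᵥ B.col j := by
    rw [sq]
    exact Finset.single_le_sum (f := fun a => B a j * B a j)
      (fun a _ => mul_self_nonneg _) (Finset.mem_univ i)
  exact abs_le_of_sq_le_sq (h2.trans h) (norm2_nonneg B)

lemma norm2_le_one_of_orthonormal {V : Matrix (Fin m) (Fin l) ℝ} (h : Vᵀ * V = 1) :
    norm2 V ≤ 1 := by
  refine norm2_le_of_mulVec zero_le_one fun x => ?_
  rw [Matrix.dotProduct_mulVec, Matrix.vecMul_mulVec, h]
  simp

lemma norm2_block_le {V : Matrix (Fin m) (Fin l) ℝ} {W : Matrix (Fin m) (Fin k) ℝ}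
    (hV : Vᵀ * V = 1) (hW : Wᵀ * W = 1) (B : Matrix (Fin m) (Fin m) ℝ) :
    norm2 (block V B W) ≤ norm2 B := by
  have h1 := norm2_mul_le (Vᵀ * B) W
  have h2 := norm2_mul_le Vᵀ B
  rw [norm2_transpose] at h2
  have h3 := norm2_le_one_of_orthonormal hV
  have h4 := norm2_le_one_of_orthonormal hW
  have h5 := norm2_nonneg B
  have h6 := norm2_nonneg (Vᵀ * B)
  unfold block
  nlinarith

/-- The norm is at most the sum of the absolute values of the entries, so a uniform entrywise
bound controls it. -/
lemma norm2_le_of_entry_le {B : Matrix (Fin m) (Fin l) ℝ} {c : ℝ} (h : ∀ i j, |B i j| ≤ c) :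
    norm2 B ≤ m * l * c := by
  have h1 : B = ∑ i, ∑ j, Matrix.single i j (B i j) := Matrix.matrix_eq_sum_single B
  have h2 : ∀ i j, norm2 (Matrix.single i j (B i j)) ≤ c := by
    intro i j
    refine (norm2_le_of_mulVec (abs_nonneg (B i j)) fun x => ?_).trans (h i j)
    rw [Matrix.single_mulVec]
    simp only [Function.update_apply, dotProduct]
    have h3 : x j * x j ≤ ∑ a, x a * x a :=
      Finset.single_le_sum (f := fun a => x a * x a)
        (fun a _ => mul_self_nonneg _) (Finset.mem_univ j)
    simp only [Pi.zero_apply, mul_ite, mul_zero, Finset.sum_ite_eq', Finset.mem_univ, ite_mul,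
      zero_mul, if_true, sq_abs]
    nlinarith [sq_nonneg (B i j)]
  unfold norm2 at *
  calc ‖B‖ = ‖∑ i, ∑ j, Matrix.single i j (B i j)‖ := by rw [← h1]
    _ ≤ ∑ i : Fin m, ∑ j : Fin l, c :=
      (norm_sum_le _ _).trans (Finset.sum_le_sum fun i _ =>
        (norm_sum_le _ _).trans (Finset.sum_le_sum fun j _ => h2 i j))
    _ = m * l * c := by simp; ring

end SpectralNorm

/-! ### The two-to-infinity norm -/

section TwoInf

variable {m l k : ℕ}

lemma normTwoInf_nonneg (B : Matrix (Fin m) (Fin l) ℝ) : 0 ≤ normTwoInf B :=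
  Real.iSup_nonneg fun _ => Real.sqrt_nonneg _

lemma sqrt_sum_row (B : Matrix (Fin m) (Fin l) ℝ) (i : Fin m) :
    Real.sqrt (∑ j, B i j ^ 2) = ‖WithLp.toLp 2 (B i)‖ := by
  rw [EuclideanSpace.norm_eq]; simp

lemma norm_row_le (B : Matrix (Fin m) (Fin l) ℝ) (i : Fin m) :
    ‖WithLp.toLp 2 (B i)‖ ≤ normTwoInf B := by
  rw [← sqrt_sum_row]
  exact le_ciSup (f := fun i => Real.sqrt (∑ j, B i j ^ 2)) (Set.finite_range _).bddAbove i

lemma normTwoInf_le {B : Matrix (Fin m) (Fin l) ℝ} {c : ℝ} (hc : 0 ≤ c)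
    (h : ∀ i, ‖WithLp.toLp 2 (B i)‖ ≤ c) : normTwoInf B ≤ c :=
  Real.iSup_le (fun i => (sqrt_sum_row B i).trans_le (h i)) hc

lemma normTwoInf_add_le (B C : Matrix (Fin m) (Fin l) ℝ) :
    normTwoInf (B + C) ≤ normTwoInf B + normTwoInf C :=
  normTwoInf_le (add_nonneg (normTwoInf_nonneg B) (normTwoInf_nonneg C)) fun i =>
    (norm_add_le (WithLp.toLp 2 (B i)) (WithLp.toLp 2 (C i))).trans
      (add_le_add (norm_row_le B i) (norm_row_le C i))

lemma normTwoInf_neg (B : Matrix (Fin m) (Fin l) ℝ) : normTwoInf (-B) = normTwoInf B := by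
  simp [normTwoInf]

lemma normTwoInf_sub_le (B C : Matrix (Fin m) (Fin l) ℝ) :
    normTwoInf (B - C) ≤ normTwoInf B + normTwoInf C := by
  rw [sub_eq_add_neg, ← normTwoInf_neg C]
  exact normTwoInf_add_le B (-C)

lemma normTwoInf_smul (c : ℝ) (B : Matrix (Fin m) (Fin l) ℝ) :
    normTwoInf (c • B) = |c| * normTwoInf B := by
  unfold normTwoInf
  rw [Real.mul_iSup_of_nonneg (abs_nonneg c)]
  congr 1 with i
  rw [sqrt_sum_row, sqrt_sum_row, ← Real.norm_eq_abs, ← norm_smul]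
  rfl

/-- A row of `B * C` is the image of the row of `B` under `Cᵀ`. -/
lemma normTwoInf_mul_le (B : Matrix (Fin m) (Fin l) ℝ) (C : Matrix (Fin l) (Fin k) ℝ) :
    normTwoInf (B * C) ≤ normTwoInf B * norm2 C := by
  refine normTwoInf_le (mul_nonneg (normTwoInf_nonneg B) (norm2_nonneg C)) fun i => ?_
  have h : (B * C) i = Cᵀ *ᵥ (B i) := by
    rw [Matrix.mulVec_transpose]; rfl
  rw [h, ← norm2_transpose C, mul_comm]
  exact (Matrix.l2_opNorm_mulVec Cᵀ (WithLp.toLp 2 (B i))).trans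
    (mul_le_mul_of_nonneg_left (norm_row_le B i) (norm2_nonneg Cᵀ))

end TwoInf

/-! ### Separations -/

section Sep

variable {m l k : ℕ}

/-- The defining inequality of a separation, for a homogeneous `N`. -/
lemma sepOn_mul_le {N : Matrix (Fin m) (Fin l) ℝ → ℝ} (h0 : ∀ B, 0 ≤ N B)
    (hs : ∀ (c : ℝ) B, N (c • B) = |c| * N B) (W : Matrix (Fin m) (Fin k) ℝ)
    (B : Matrix (Fin l) (Fin l) ℝ) (C : Matrix (Fin m) (Fin m) ℝ)
    (X : Matrix (Fin k) (Fin l) ℝ) :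
    sepOn N W B C * N (W * X) ≤ N ((W * X) * B - C * (W * X)) := by
  rcases (h0 (W * X)).eq_or_lt with hz | hz
  · rw [← hz, mul_zero]; exact h0 _
  · set c := (N (W * X))⁻¹ with hc
    have hc0 : 0 < c := inv_pos.2 hz
    have h1 : sepOn N W B C ≤ c * N ((W * X) * B - C * (W * X)) := by
      refine csInf_le ⟨0, ?_⟩ ⟨c • (W * X), ⟨c • X, by simp⟩, ?_, ?_⟩
      · rintro _ ⟨Z, -, -, rfl⟩; exact h0 _
      · rw [hs, abs_of_pos hc0, hc, inv_mul_cancel₀ hz.ne']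
      · rw [Matrix.smul_mul, Matrix.mul_smul, ← smul_sub, hs, abs_of_pos hc0]
    calc sepOn N W B C * N (W * X)
        ≤ (c * N ((W * X) * B - C * (W * X))) * N (W * X) :=
          mul_le_mul_of_nonneg_right h1 hz.le
      _ = N ((W * X) * B - C * (W * X)) := by rw [hc]; field_simp

lemma sep_eq_sepOn (N : Matrix (Fin m) (Fin l) ℝ → ℝ)
    (B : Matrix (Fin l) (Fin l) ℝ) (C : Matrix (Fin m) (Fin m) ℝ) :
    sep N B C = sepOn N (1 : Matrix (Fin m) (Fin m) ℝ) B C := by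
  unfold sep sepOn
  congr 1; ext c
  simp

lemma sep_norm2_mul_le (B : Matrix (Fin l) (Fin l) ℝ) (C : Matrix (Fin m) (Fin m) ℝ)
    (X : Matrix (Fin m) (Fin l) ℝ) :
    sep norm2 B C * norm2 X ≤ norm2 (X * B - C * X) := by
  have h := sepOn_mul_le (N := norm2) norm2_nonneg norm2_smul 1 B C X
  rwa [← sep_eq_sepOn, Matrix.one_mul] at h

/-- Tested on the matrix unit `e_i e_jᵀ`, which the Sylvester operator multiplies by
`μ₁ j - μ₂ i`. -/
lemma sep_norm2_diagonal_le (μ₁ : Fin l → ℝ) (μ₂ : Fin m → ℝ) (i : Fin m) (j : Fin l) :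
    sep norm2 (Matrix.diagonal μ₁) (Matrix.diagonal μ₂) ≤ |μ₁ j - μ₂ i| := by
  have h := sep_norm2_mul_le (Matrix.diagonal μ₁) (Matrix.diagonal μ₂) (Matrix.single i j (1 : ℝ))
  have e : Matrix.single i j (1 : ℝ) * Matrix.diagonal μ₁ -
      Matrix.diagonal μ₂ * Matrix.single i j (1 : ℝ) =
        (μ₁ j - μ₂ i) • Matrix.single i j (1 : ℝ) := by
    ext a b
    simp only [Matrix.sub_apply, Matrix.mul_diagonal, Matrix.diagonal_mul, Matrix.smul_apply,
      Matrix.single_apply, smul_eq_mul]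
    split_ifs with hab
    · rw [← hab.1, ← hab.2]; ring
    · ring
  rw [e, norm2_smul] at h
  refine le_of_mul_le_mul_right h ((norm2_nonneg _).lt_of_ne' fun h0 => ?_)
  have := congrFun (congrFun (norm2_eq_zero.1 h0) i) j
  simp at this

/-- The Sylvester operator of two diagonal matrices scales the `(i, j)` entry by `μ₁ j - μ₂ i`,
and the norm is comparable with the largest entry. -/
lemma sep_norm2_diagonal_pos (hm : 0 < m) (hl : 0 < l) {μ₁ : Fin l → ℝ} {μ₂ : Fin m → ℝ} {d : ℝ}
    (hd : 0 < d) (h : ∀ i j, d ≤ μ₁ j - μ₂ i) :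
    0 < sep norm2 (Matrix.diagonal μ₁) (Matrix.diagonal μ₂) := by
  have hm' : (0 : ℝ) < m := by exact_mod_cast hm
  have hl' : (0 : ℝ) < l := by exact_mod_cast hl
  have key : ∀ Z : Matrix (Fin m) (Fin l) ℝ, norm2 Z ≤
      m * l * (norm2 (Z * Matrix.diagonal μ₁ - Matrix.diagonal μ₂ * Z) / d) := by
    intro Z
    refine norm2_le_of_entry_le fun i j => ?_
    have h1 := abs_entry_le_norm2 (Z * Matrix.diagonal μ₁ - Matrix.diagonal μ₂ * Z) i j
    rw [le_div_iff₀ hd]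
    refine le_trans ?_ h1
    rw [Matrix.sub_apply, Matrix.mul_diagonal, Matrix.diagonal_mul, mul_comm (μ₂ i), ← mul_sub,
      abs_mul]
    exact mul_le_mul_of_nonneg_left ((h i j).trans (le_abs_self _)) (abs_nonneg _)
  refine lt_of_lt_of_le (b := d / (m * l)) (by positivity) (le_csInf ?_ ?_)
  · have h1 : norm2 (Matrix.single (⟨0, hm⟩ : Fin m) (⟨0, hl⟩ : Fin l) (1 : ℝ)) ≠ 0 := fun h0 => by
      have := congrFun (congrFun (norm2_eq_zero.1 h0) ⟨0, hm⟩) ⟨0, hl⟩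
      simp at this
    refine ⟨_, (norm2 (Matrix.single (⟨0, hm⟩ : Fin m) (⟨0, hl⟩ : Fin l) (1 : ℝ)))⁻¹ •
      Matrix.single (⟨0, hm⟩ : Fin m) (⟨0, hl⟩ : Fin l) (1 : ℝ), ?_, rfl⟩
    rw [norm2_smul, abs_of_nonneg (inv_nonneg.2 (norm2_nonneg _)), inv_mul_cancel₀ h1]
  · rintro _ ⟨Z, hZ, rfl⟩
    have := key Z
    rw [hZ] at this
    rw [div_le_iff₀ (by positivity)]
    rw [mul_div_assoc', le_div_iff₀ hd] at this
    linarith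

end Sep

/-! ### The chord iteration -/

section Iteration

/-- Banach's fixed point theorem on a ball about the starting point `0`. -/
lemma exists_tendsto_of_contraction {X : Type*} [NormedAddCommGroup X] [CompleteSpace X]
    {T : X → X} {ρ k : ℝ} (hρ : 0 ≤ ρ) (hk0 : 0 ≤ k) (hk : k < 1)
    (hball : ∀ x, ‖x‖ ≤ ρ → ‖T x‖ ≤ ρ)
    (hcontr : ∀ x y, ‖x‖ ≤ ρ → ‖y‖ ≤ ρ → ‖T x - T y‖ ≤ k * ‖x - y‖)
    {u : ℕ → X} (h0 : u 0 = 0) (hu : ∀ t, u (t + 1) = T (u t)) :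
    ∃ x, Filter.Tendsto u Filter.atTop (𝓝 x) ∧ ‖x‖ ≤ ρ ∧ T x = x := by
  have hb : ∀ t, ‖u t‖ ≤ ρ := by
    intro t
    induction t with
    | zero => simpa [h0] using hρ
    | succ t ih => rw [hu]; exact hball _ ih
  have hg : ∀ t, dist (u t) (u (t + 1)) ≤ ‖u 1‖ * k ^ t := by
    intro t
    induction t with
    | zero => simp [h0]
    | succ t ih =>
      rw [dist_eq_norm] at ih ⊢
      rw [hu t, hu (t + 1), pow_succ]
      have := hcontr _ _ (hb t) (hb (t + 1))
      rw [← hu t] at this ⊢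
      nlinarith
  obtain ⟨x, hx⟩ := cauchySeq_tendsto_of_complete (cauchySeq_of_le_geometric k _ hk hg)
  have hxρ : ‖x‖ ≤ ρ := le_of_tendsto hx.norm (Filter.Eventually.of_forall hb)
  refine ⟨x, hx, hxρ, ?_⟩
  have hT : Filter.Tendsto (fun t => u (t + 1)) Filter.atTop (𝓝 (T x)) := by
    rw [tendsto_iff_norm_sub_tendsto_zero] at hx ⊢
    refine squeeze_zero (fun _ => norm_nonneg _) (fun t => ?_)
      (by simpa using hx.const_mul k)
    rw [hu]
    exact hcontr _ _ (hb t) hxρ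
  exact tendsto_nhds_unique hT (hx.comp (Filter.tendsto_add_atTop_nat 1))

variable {n r : ℕ} {V₁ : Matrix (Fin n) (Fin r) ℝ} {V₂ : Matrix (Fin n) (Fin (n - r)) ℝ}
  {B : Matrix (Fin n) (Fin n) ℝ}

lemma sylvester_sub (X Y : Matrix (Fin (n - r)) (Fin r) ℝ) :
    sylvester V₁ V₂ B (X - Y) = sylvester V₁ V₂ B X - sylvester V₁ V₂ B Y := by
  simp only [sylvester, Matrix.sub_mul, Matrix.mul_sub]; abel

/-- A linear endomorphism of a finite-dimensional space that is bounded below is bijective. -/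
lemma sylvester_bijective {σ : ℝ} (hσ : 0 < σ)
    (h : ∀ Z, σ * norm2 Z ≤ norm2 (sylvester V₁ V₂ B Z)) :
    Function.Bijective (sylvester V₁ V₂ B) := by
  have hinj : Function.Injective (sylvester V₁ V₂ B) := by
    intro X Y hXY
    have h1 := h (X - Y)
    rw [sylvester_sub, hXY, sub_self, norm2_eq_zero.2 rfl] at h1
    have h2 : norm2 (X - Y) = 0 := by nlinarith [norm2_nonneg (X - Y)]
    exact sub_eq_zero.1 (norm2_eq_zero.1 h2)
  let S : Matrix (Fin (n - r)) (Fin r) ℝ →ₗ[ℝ] Matrix (Fin (n - r)) (Fin r) ℝ :=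
    { toFun := sylvester V₁ V₂ B
      map_add' := fun X Y => by simp only [sylvester, Matrix.add_mul, Matrix.mul_add]; abel
      map_smul' := fun c X => by simp [sylvester, smul_sub] }
  exact ⟨hinj, LinearMap.injective_iff_surjective.1 (show Function.Injective S from hinj)⟩

lemma quadMap_eq (X : Matrix (Fin (n - r)) (Fin r) ℝ) :
    quadMap V₁ V₂ B X =
      sylvester V₁ V₂ B X - (block V₂ B V₁ - X * block V₁ B V₂ * X) := by
  simp only [quadMap, sylvester]; abel

section
open scoped Matrix.Norms.L2Operator

/-- The chord iteration is the fixed point iteration of `X ↦ S⁻¹ (B₂₁ - X B₁₂ X)`, which maps the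
ball of radius `ρ` to itself and is a contraction there. -/
lemma newtonSeq_tendsto {σ γ ρ : ℝ} (hσ : 0 < σ) (hρ : 0 ≤ ρ)
    (h : ∀ Z, σ * norm2 Z ≤ norm2 (sylvester V₁ V₂ B Z))
    (h21 : norm2 (block V₂ B V₁) ≤ γ) (h12 : norm2 (block V₁ B V₂) ≤ γ)
    (hρ1 : γ + γ * ρ ^ 2 ≤ σ * ρ) (hρ2 : 2 * γ * ρ < σ) :
    ∃ X, Filter.Tendsto (newtonSeq V₁ V₂ B) Filter.atTop (𝓝 X) ∧ norm2 X ≤ ρ ∧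
      quadMap V₁ V₂ B X = 0 := by
  have hbij := sylvester_bijective hσ h
  have hinv : ∀ Y, sylvester V₁ V₂ B (Function.invFun (sylvester V₁ V₂ B) Y) = Y :=
    Function.rightInverse_invFun hbij.2
  set T : Matrix (Fin (n - r)) (Fin r) ℝ → Matrix (Fin (n - r)) (Fin r) ℝ := fun X =>
    Function.invFun (sylvester V₁ V₂ B) (block V₂ B V₁ - X * block V₁ B V₂ * X) with hT
  have hST : ∀ X, sylvester V₁ V₂ B (T X) = block V₂ B V₁ - X * block V₁ B V₂ * X :=
    fun X => hinv _
  have hγ : 0 ≤ γ := (norm2_nonneg _).trans h21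
  have hprod : ∀ X Y : Matrix (Fin (n - r)) (Fin r) ℝ,
      norm2 (X * block V₁ B V₂ * Y) ≤ norm2 X * γ * norm2 Y := fun X Y =>
    (norm2_mul_le _ _).trans (mul_le_mul_of_nonneg_right ((norm2_mul_le _ _).trans
      (mul_le_mul_of_nonneg_left h12 (norm2_nonneg X))) (norm2_nonneg Y))
  have hball : ∀ X, norm2 X ≤ ρ → norm2 (T X) ≤ ρ := by
    intro X hX
    have h1 := h (T X)
    rw [hST] at h1
    have h2 := norm2_sub_le (block V₂ B V₁) (X * block V₁ B V₂ * X)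
    have h3 := hprod X X
    have h4 : norm2 X * γ * norm2 X ≤ γ * ρ ^ 2 := by
      have := mul_le_mul hX hX (norm2_nonneg X) hρ
      nlinarith
    refine le_of_mul_le_mul_left ?_ hσ
    linarith
  have hcontr : ∀ X Y, norm2 X ≤ ρ → norm2 Y ≤ ρ →
      norm2 (T X - T Y) ≤ (2 * γ * ρ / σ) * norm2 (X - Y) := by
    intro X Y hX hY
    have h1 := h (T X - T Y)
    have e : sylvester V₁ V₂ B (T X - T Y) =
        -((X - Y) * block V₁ B V₂ * X + Y * block V₁ B V₂ * (X - Y)) := by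
      rw [sylvester_sub, hST, hST]
      simp only [Matrix.sub_mul, Matrix.mul_sub]; abel
    rw [e] at h1
    have h2 : norm2 (-((X - Y) * block V₁ B V₂ * X + Y * block V₁ B V₂ * (X - Y))) ≤
        norm2 ((X - Y) * block V₁ B V₂ * X) + norm2 (Y * block V₁ B V₂ * (X - Y)) := by
      unfold norm2; rw [norm_neg]; exact norm_add_le _ _
    have h3 := hprod (X - Y) X
    have h4 := hprod Y (X - Y)
    have h5 : norm2 (X - Y) * γ * norm2 X ≤ norm2 (X - Y) * γ * ρ :=
      mul_le_mul_of_nonneg_left hX (mul_nonneg (norm2_nonneg _) hγ)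
    have h6 : norm2 Y * γ * norm2 (X - Y) ≤ ρ * γ * norm2 (X - Y) :=
      mul_le_mul_of_nonneg_right (mul_le_mul_of_nonneg_right hY hγ) (norm2_nonneg _)
    rw [div_mul_eq_mul_div, le_div_iff₀ hσ]
    linarith
  have hu : ∀ t, newtonSeq V₁ V₂ B (t + 1) = T (newtonSeq V₁ V₂ B t) := by
    intro t
    apply hbij.1
    rw [hST]
    change sylvester V₁ V₂ B (newtonSeq V₁ V₂ B t - Function.invFun (sylvester V₁ V₂ B)
      (quadMap V₁ V₂ B (newtonSeq V₁ V₂ B t))) = _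
    rw [sylvester_sub, hinv, quadMap_eq]
    abel
  obtain ⟨X, hX, hXρ, hfix⟩ := exists_tendsto_of_contraction (T := T) (k := 2 * γ * ρ / σ) hρ
    (by positivity) ((div_lt_one hσ).2 hρ2) hball hcontr (u := newtonSeq V₁ V₂ B) rfl hu
  refine ⟨X, hX, hXρ, ?_⟩
  have h1 := hST X
  rw [hfix] at h1
  rw [quadMap_eq, h1, sub_self]

end

end Iteration

/-! ### Blocks of the perturbed matrix -/

section Blocks

variable {n r k l : ℕ} {A E : Matrix (Fin n) (Fin n) ℝ}
  {V₁ : Matrix (Fin n) (Fin r) ℝ} {V₂ : Matrix (Fin n) (Fin (n - r)) ℝ}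
  {μ₁ : Fin r → ℝ} {μ₂ : Fin (n - r) → ℝ}

lemma block_add (V : Matrix (Fin n) (Fin k) ℝ) (W : Matrix (Fin n) (Fin l) ℝ) :
    block V (A + E) W = block V A W + block V E W := by
  simp [block, Matrix.mul_add, Matrix.add_mul]

lemma block_transpose (V : Matrix (Fin n) (Fin k) ℝ) (W : Matrix (Fin n) (Fin l) ℝ) :
    (block V A W)ᵀ = block W Aᵀ V := by
  simp [block, Matrix.mul_assoc]

namespace IsOrderedEigendecomp

lemma orth₂₁ (h : IsOrderedEigendecomp A V₁ V₂ μ₁ μ₂) : V₂ᵀ * V₁ = 0 := by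
  have := congrArg Matrix.transpose h.orth₁₂
  simpa using this

lemma mul_left (h : IsOrderedEigendecomp A V₁ V₂ μ₁ μ₂) : A * V₁ = V₁ * Matrix.diagonal μ₁ := by
  rw [h.eq, Matrix.add_mul, Matrix.mul_assoc _ _ V₁, h.orth₁, Matrix.mul_assoc _ _ V₁, h.orth₂₁]
  simp

lemma mul_right (h : IsOrderedEigendecomp A V₁ V₂ μ₁ μ₂) :
    A * V₂ = V₂ * Matrix.diagonal μ₂ := by
  rw [h.eq, Matrix.add_mul, Matrix.mul_assoc _ _ V₂, h.orth₁₂, Matrix.mul_assoc _ _ V₂, h.orth₂]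
  simp

lemma block₁₁ (h : IsOrderedEigendecomp A V₁ V₂ μ₁ μ₂) :
    block V₁ A V₁ = Matrix.diagonal μ₁ := by
  rw [block, Matrix.mul_assoc, h.mul_left, ← Matrix.mul_assoc, h.orth₁, Matrix.one_mul]

lemma block₂₂ (h : IsOrderedEigendecomp A V₁ V₂ μ₁ μ₂) :
    block V₂ A V₂ = Matrix.diagonal μ₂ := by
  rw [block, Matrix.mul_assoc, h.mul_right, ← Matrix.mul_assoc, h.orth₂, Matrix.one_mul]

lemma block₁₂ (h : IsOrderedEigendecomp A V₁ V₂ μ₁ μ₂) : block V₁ A V₂ = 0 := by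
  rw [block, Matrix.mul_assoc, h.mul_right, ← Matrix.mul_assoc, h.orth₁₂, Matrix.zero_mul]

lemma block₂₁ (h : IsOrderedEigendecomp A V₁ V₂ μ₁ μ₂) : block V₂ A V₁ = 0 := by
  rw [block, Matrix.mul_assoc, h.mul_left, ← Matrix.mul_assoc, h.orth₂₁, Matrix.zero_mul]

lemma completeness (h : IsOrderedEigendecomp A V₁ V₂ μ₁ μ₂) (hrn : r < n) :
    V₁ * V₁ᵀ + V₂ * V₂ᵀ = 1 := by
  have e : Fin n ≃ Fin r ⊕ Fin (n - r) :=
    (finCongr (by omega)).trans finSumFinEquiv.symm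
  rw [← Matrix.fromCols_mul_fromRows, Matrix.fromCols_mul_fromRows_eq_one_comm e,
    Matrix.fromRows_mul_fromCols, h.orth₁, h.orth₂, h.orth₁₂, h.orth₂₁, Matrix.fromBlocks_one]

lemma transpose_eq (h : IsOrderedEigendecomp A V₁ V₂ μ₁ μ₂) : Aᵀ = A := by
  rw [h.eq]
  simp [Matrix.mul_assoc]

/-- The Sylvester operator of the perturbed matrix loses at most `2 ‖E‖` of the separation. -/
lemma sylvester_lower (h : IsOrderedEigendecomp A V₁ V₂ μ₁ μ₂)
    (Z : Matrix (Fin (n - r)) (Fin r) ℝ) :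
    (sep norm2 (Matrix.diagonal μ₁) (Matrix.diagonal μ₂) - 2 * norm2 E) * norm2 Z ≤
      norm2 (sylvester V₁ V₂ (A + E) Z) := by
  have h0 := sep_norm2_mul_le (Matrix.diagonal μ₁) (Matrix.diagonal μ₂) Z
  have e : Z * Matrix.diagonal μ₁ - Matrix.diagonal μ₂ * Z =
      sylvester V₁ V₂ (A + E) Z - (Z * block V₁ E V₁ - block V₂ E V₂ * Z) := by
    rw [sylvester, block_add, block_add, h.block₁₁, h.block₂₂]
    simp only [Matrix.mul_add, Matrix.add_mul]; abel
  rw [e] at h0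
  have h1 := norm2_sub_le (sylvester V₁ V₂ (A + E) Z) (Z * block V₁ E V₁ - block V₂ E V₂ * Z)
  have h2 := norm2_sub_le (Z * block V₁ E V₁) (block V₂ E V₂ * Z)
  have h3 := norm2_mul_le Z (block V₁ E V₁)
  have h4 := norm2_mul_le (block V₂ E V₂) Z
  have h5 := mul_le_mul_of_nonneg_left (norm2_block_le h.orth₁ h.orth₁ E) (norm2_nonneg Z)
  have h6 := mul_le_mul_of_nonneg_right (norm2_block_le h.orth₂ h.orth₂ E) (norm2_nonneg Z)
  linarith

end IsOrderedEigendecomp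

end Blocks

/-! ### The orthogonal Procrustes problem -/

section Procrustes

variable {n r l : ℕ}

lemma normF_sq (B : Matrix (Fin n) (Fin l) ℝ) : normF B ^ 2 = (Bᵀ * B).trace := by
  have h : normF B ^ 2 = ∑ i, ∑ j, B i j ^ 2 := Real.sq_sqrt
    (Finset.sum_nonneg fun _ _ => Finset.sum_nonneg fun _ _ => sq_nonneg _)
  rw [h, Finset.sum_comm]
  simp [Matrix.trace, Matrix.mul_apply, sq]

/-- Expanding the square, the objective of the Procrustes problem is a constant minus
`2 tr (Vᵀ W U)`. -/
lemma normF_mul_sub_sq {W V : Matrix (Fin n) (Fin r) ℝ} {U : Matrix (Fin r) (Fin r) ℝ}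
    (hW : Wᵀ * W = 1) (hV : Vᵀ * V = 1) (hU : U ∈ Matrix.orthogonalGroup (Fin r) ℝ) :
    normF (W * U - V) ^ 2 = 2 * r - 2 * (Vᵀ * W * U).trace := by
  have hU' : Uᵀ * U = 1 := (Matrix.mem_orthogonalGroup_iff' (Fin r) ℝ).1 hU
  have e : (W * U - V)ᵀ * (W * U - V) =
      Uᵀ * (Wᵀ * W) * U - (Vᵀ * W * U)ᵀ - Vᵀ * W * U + Vᵀ * V := by
    simp only [Matrix.transpose_sub, Matrix.transpose_mul, Matrix.sub_mul, Matrix.mul_sub,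
      Matrix.transpose_transpose, Matrix.mul_assoc]
    abel
  rw [normF_sq, e, hW, hV, Matrix.mul_one, hU', Matrix.trace_add, Matrix.trace_sub,
    Matrix.trace_sub, Matrix.trace_transpose, Matrix.trace_one, Fintype.card_fin]
  ring

open scoped MatrixOrder in
lemma exists_posSemidef_mul_self {M : Matrix (Fin r) (Fin r) ℝ} (hM : M.PosSemidef) :
    ∃ S : Matrix (Fin r) (Fin r) ℝ, S.PosSemidef ∧ S * S = M :=
  ⟨CFC.sqrt M, Matrix.nonneg_iff_posSemidef.1 (CFC.sqrt_nonneg M), CFC.sqrt_mul_sqrt_self M (Matrix.nonneg_iff_posSemidef.2 hM)⟩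

/-- At a solution of the Procrustes problem `Vᵀ W U` is the positive semidefinite polar factor of
`Vᵀ W`: with `Vᵀ W = S Q` the polar decomposition and `O = Q U`, optimality against `Qᵀ` gives
`tr ((1 - O)ᵀ S (1 - O)) = 2 (tr S - tr (S O)) ≤ 0`, hence `O = 1`. -/
lemma IsProcrustesSolution.posSemidef {W V : Matrix (Fin n) (Fin r) ℝ}
    {U : Matrix (Fin r) (Fin r) ℝ} (h : IsProcrustesSolution W V U)
    (hW : Wᵀ * W = 1) (hV : Vᵀ * V = 1) (hdet : IsUnit (Vᵀ * W).det) :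
    (Vᵀ * W * U).PosSemidef := by
  set M := Vᵀ * W with hM
  obtain ⟨S, hS, hSS⟩ := exists_posSemidef_mul_self (M := M * Mᵀ)
    (by simpa using Matrix.posSemidef_self_mul_conjTranspose M)
  have hSt : Sᵀ = S := by simpa [Matrix.IsHermitian] using hS.isHermitian
  have hSdet : IsUnit S.det := by
    have : S.det * S.det = M.det * M.det := by
      rw [← Matrix.det_mul, hSS, Matrix.det_mul, Matrix.det_transpose]
    exact isUnit_of_mul_isUnit_left (this ▸ hdet.mul hdet)
  have hU : Uᵀ * U = 1 := (Matrix.mem_orthogonalGroup_iff' (Fin r) ℝ).1 h.1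
  set Q := S⁻¹ * M with hQ
  have hSQ : S * Q = M := by rw [hQ, Matrix.mul_nonsing_inv_cancel_left _ _ hSdet]
  have hQQ : Q * Qᵀ = 1 := by
    rw [hQ, Matrix.transpose_mul, Matrix.transpose_nonsing_inv, hSt, Matrix.mul_assoc,
      ← Matrix.mul_assoc M, ← hSS, Matrix.mul_assoc S, Matrix.mul_nonsing_inv _ hSdet,
      Matrix.mul_one, Matrix.nonsing_inv_mul _ hSdet]
  have hQQ' : Qᵀ * Q = 1 := mul_eq_one_comm.1 hQQ
  have hQmem : Qᵀ ∈ Matrix.orthogonalGroup (Fin r) ℝ := by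
    rw [Matrix.mem_orthogonalGroup_iff]
    simpa [Matrix.star_eq_conjTranspose] using hQQ'
  have hopt : S.trace ≤ (M * U).trace := by
    have h1 := pow_le_pow_left₀ (Real.sqrt_nonneg _) (h.2 _ hQmem) 2
    rw [← normF, normF_mul_sub_sq hW hV h.1, normF_mul_sub_sq hW hV hQmem, ← hM] at h1
    have h2 : M * Qᵀ = S := by rw [← hSQ, Matrix.mul_assoc, hQQ, Matrix.mul_one]
    rw [h2] at h1
    linarith
  set O := Q * U with hO
  have hSO : S * O = M * U := by rw [hO, ← Matrix.mul_assoc, hSQ]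
  have hOO : O * Oᵀ = 1 := by
    rw [hO, Matrix.transpose_mul, Matrix.mul_assoc, ← Matrix.mul_assoc U,
      mul_eq_one_comm.1 hU, Matrix.one_mul, hQQ]
  have htr : ((1 - O)ᵀ * S * (1 - O)).trace = 2 * (S.trace - (S * O).trace) := by
    have e : (1 - O)ᵀ * S * (1 - O) = S - S * O - (S * O)ᵀ + Oᵀ * (S * O) := by
      simp only [Matrix.transpose_sub, Matrix.transpose_one, Matrix.sub_mul, Matrix.mul_sub,
        Matrix.one_mul, Matrix.mul_one, Matrix.transpose_mul, hSt, Matrix.mul_assoc]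
      abel
    rw [e, Matrix.trace_add, Matrix.trace_sub, Matrix.trace_sub, Matrix.trace_transpose,
      Matrix.trace_mul_comm Oᵀ, Matrix.mul_assoc, hOO, Matrix.mul_one]
    ring
  obtain ⟨R, hR⟩ : ∃ R : Matrix (Fin r) (Fin r) ℝ, S = Rᵀ * R := by
    obtain ⟨R, hR, hRR⟩ := exists_posSemidef_mul_self hS
    have : Rᵀ = R := by simpa [Matrix.IsHermitian] using hR.isHermitian
    exact ⟨R, by rw [this, hRR]⟩
  have hzero : R * (1 - O) = 0 := by
    rw [← Matrix.trace_conjTranspose_mul_self_eq_zero_iff]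
    have hnn := (Matrix.posSemidef_conjTranspose_mul_self (R * (1 - O))).trace_nonneg
    have e : (R * (1 - O))ᴴ * (R * (1 - O)) = (1 - O)ᵀ * S * (1 - O) := by
      rw [hR, Matrix.conjTranspose_eq_transpose_of_trivial, Matrix.transpose_mul]
      simp only [Matrix.mul_assoc]
    rw [e, htr, hSO] at hnn ⊢
    linarith
  have h2 : S * (1 - O) = 0 := by rw [hR, Matrix.mul_assoc, hzero, Matrix.mul_zero]
  rw [Matrix.mul_sub, Matrix.mul_one, sub_eq_zero, hSO] at h2
  exact h2 ▸ hS

lemma mulVec_dotProduct_mulVec {m : ℕ} (B : Matrix (Fin m) (Fin l) ℝ) (x : Fin l → ℝ) :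
    (B *ᵥ x) ⬝ᵥ (B *ᵥ x) = x ⬝ᵥ ((Bᵀ * B) *ᵥ x) := by
  rw [← Matrix.mulVec_mulVec, Matrix.dotProduct_mulVec x, Matrix.vecMul_transpose]

/-- A positive semidefinite `P` with `P (1 + Xᵀ X) P = 1` is `(1 + Xᵀ X)^(-1/2)`. The estimate
of `P - 1` comes from `(1 + P) (1 - P) = P Xᵀ X P` and `1 + P ≥ 1`. -/
lemma norm2_le_of_posSemidef_mul_mul_eq_one {P : Matrix (Fin r) (Fin r) ℝ}
    {X : Matrix (Fin l) (Fin r) ℝ}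
    (hP : P.PosSemidef) (h : P * (1 + Xᵀ * X) * P = 1) :
    norm2 P ≤ 1 ∧ norm2 (P - 1) ≤ norm2 X ^ 2 := by
  have hPt : Pᵀ = P := by simpa [Matrix.IsHermitian] using hP.isHermitian
  have h' : P * P + (X * P)ᵀ * (X * P) = 1 := by
    rw [← h, Matrix.transpose_mul, hPt]
    simp only [Matrix.mul_add, Matrix.add_mul, Matrix.mul_one, Matrix.mul_assoc]
  have hP1 : norm2 P ≤ 1 := by
    refine norm2_le_of_mulVec zero_le_one fun x => ?_
    have h1 := congrArg (fun B => x ⬝ᵥ (B *ᵥ x)) h'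
    simp only [Matrix.add_mulVec, dotProduct_add, Matrix.one_mulVec,
      ← mulVec_dotProduct_mulVec] at h1
    rw [mulVec_dotProduct_mulVec P, hPt]
    linarith [dotProduct_self_nonneg' ((X * P) *ᵥ x)]
  refine ⟨hP1, ?_⟩
  have hXP : norm2 ((X * P)ᵀ * (X * P)) ≤ norm2 X ^ 2 := by
    have h1 := norm2_mul_le (X * P)ᵀ (X * P)
    rw [norm2_transpose] at h1
    have h2 : norm2 (X * P) ≤ norm2 X := (norm2_mul_le X P).trans
      (mul_le_of_le_one_right (norm2_nonneg X) hP1)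
    nlinarith [norm2_nonneg (X * P)]
  have hfac : (1 + P) * (P - 1) = -((X * P)ᵀ * (X * P)) := by
    rw [← sub_eq_zero, ← sub_eq_zero.2 h']
    simp only [Matrix.add_mul, Matrix.mul_sub, Matrix.one_mul, Matrix.mul_one]
    abel
  refine norm2_le_of_mulVec (by positivity) fun x => ?_
  set w := (P - 1) *ᵥ x with hw
  have h1 : (1 + P) *ᵥ w = -(((X * P)ᵀ * (X * P)) *ᵥ x) := by
    rw [hw, Matrix.mulVec_mulVec, hfac, Matrix.neg_mulVec]
  have h2 := mulVec_dotProduct_self_le ((X * P)ᵀ * (X * P)) x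
  have h3 : w ⬝ᵥ w ≤ ((1 + P) *ᵥ w) ⬝ᵥ ((1 + P) *ᵥ w) := by
    have h4 : 0 ≤ w ⬝ᵥ (P *ᵥ w) := by simpa using hP.dotProduct_mulVec_nonneg w
    rw [Matrix.add_mulVec, Matrix.one_mulVec, add_dotProduct, dotProduct_add, dotProduct_add,
      dotProduct_comm (P *ᵥ w) w]
    linarith [dotProduct_self_nonneg' (P *ᵥ w)]
  rw [h1, neg_dotProduct, dotProduct_neg, neg_neg] at h3
  calc w ⬝ᵥ w ≤ _ := h3
    _ ≤ _ := h2
    _ ≤ (norm2 X ^ 2) ^ 2 * (x ⬝ᵥ x) := mul_le_mul_of_nonneg_right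
      (pow_le_pow_left₀ (norm2_nonneg _) hXP 2) (dotProduct_self_nonneg' x)

end Procrustes

/-! ### The dominant invariant subspace -/

section Invariant

variable {n r p q : ℕ}

/-- A nonzero row of `K` with `K L = diag(ν) K` is a left eigenvector of `L`, so its eigenvalue
lies in the numerical range of `L`. -/
lemma eigenvalue_of_row {K : Matrix (Fin p) (Fin q) ℝ} {L : Matrix (Fin q) (Fin q) ℝ}
    {ν : Fin p → ℝ} (h : K * L = Matrix.diagonal ν * K) (i : Fin p) :
    K i ⬝ᵥ (L *ᵥ K i) = ν i * (K i ⬝ᵥ K i) := by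
  have h1 : K i ᵥ* L = ν i • K i := by
    have := congrFun h i
    rw [← Matrix.mul_apply_eq_vecMul, this]
    ext j
    rw [Matrix.diagonal_mul]; rfl
  rw [Matrix.dotProduct_mulVec, h1, smul_dotProduct, smul_eq_mul]

lemma dotProduct_self_pos_of_ne {x : Fin q → ℝ} (hx : x ≠ 0) : 0 < x ⬝ᵥ x :=
  (dotProduct_self_nonneg' x).lt_of_ne' fun h => hx (dotProduct_self_eq_zero.1 h)

lemma isUnit_det_one_add_transpose_mul_self (X : Matrix (Fin p) (Fin q) ℝ) :
    IsUnit (1 + Xᵀ * X).det := by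
  have h : (1 + Xᵀ * X).PosDef := Matrix.PosDef.one.add_posSemidef
    (by simpa using Matrix.posSemidef_conjTranspose_mul_self X)
  exact (Matrix.isUnit_iff_isUnit_det _).1 h.isUnit

lemma isUnit_det_of_transpose_mul_self {T : Matrix (Fin q) (Fin q) ℝ}
    (h : IsUnit (Tᵀ * T).det) : IsUnit T.det := by
  rw [Matrix.det_mul] at h
  exact isUnit_of_mul_isUnit_right h

/-- If `M G = G L` and `M H = H L₂` for full-rank `G ⟂ H`, and the numerical ranges of `L` and `L₂`
are separated, then the range of `G` is orthogonal to the eigenvectors in `W₂`. The rows of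
`W₂ᵀ G` are left eigenvectors of `L`; if one of them is nonzero, then all `ν₁` are large, which
forces `W₁ᵀ H = 0` and so the range of `H` is that of `W₂`, orthogonal to `G`. -/
lemma IsOrderedEigendecomp.transpose_mul_eq_zero {M : Matrix (Fin n) (Fin n) ℝ}
    {W₁ : Matrix (Fin n) (Fin r) ℝ} {W₂ : Matrix (Fin n) (Fin (n - r)) ℝ}
    {ν₁ : Fin r → ℝ} {ν₂ : Fin (n - r) → ℝ}
    (h : IsOrderedEigendecomp M W₁ W₂ ν₁ ν₂) (hrn : r < n)
    {G : Matrix (Fin n) (Fin r) ℝ} {H : Matrix (Fin n) (Fin (n - r)) ℝ}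
    {L : Matrix (Fin r) (Fin r) ℝ} {L₂ : Matrix (Fin (n - r)) (Fin (n - r)) ℝ}
    (hG : M * G = G * L) (hH : M * H = H * L₂) (hHG : Hᵀ * G = 0)
    (hHH : IsUnit (Hᵀ * H).det) {a b : ℝ} (hab : b < a)
    (hL : ∀ x, a * (x ⬝ᵥ x) ≤ x ⬝ᵥ (L *ᵥ x)) (hL₂ : ∀ y, y ⬝ᵥ (L₂ *ᵥ y) ≤ b * (y ⬝ᵥ y)) :
    W₂ᵀ * G = 0 := by
  have hleft : W₁ᵀ * M = Matrix.diagonal ν₁ * W₁ᵀ := by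
    have := congrArg Matrix.transpose h.mul_left
    simpa [h.transpose_eq] using this
  have hright : W₂ᵀ * M = Matrix.diagonal ν₂ * W₂ᵀ := by
    have := congrArg Matrix.transpose h.mul_right
    simpa [h.transpose_eq] using this
  have hK : W₂ᵀ * G * L = Matrix.diagonal ν₂ * (W₂ᵀ * G) := by
    rw [Matrix.mul_assoc, ← hG, ← Matrix.mul_assoc, hright, Matrix.mul_assoc]
  have hJ : W₁ᵀ * H * L₂ = Matrix.diagonal ν₁ * (W₁ᵀ * H) := by
    rw [Matrix.mul_assoc, ← hH, ← Matrix.mul_assoc, hleft, Matrix.mul_assoc]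
  by_contra hne
  obtain ⟨j, hj⟩ : ∃ j, (W₂ᵀ * G) j ≠ 0 := by
    by_contra! hall
    exact hne (funext hall)
  have hνj : a ≤ ν₂ j := by
    have h1 := hL ((W₂ᵀ * G) j)
    rw [eigenvalue_of_row hK] at h1
    exact le_of_mul_le_mul_right h1 (dotProduct_self_pos_of_ne hj)
  have hJ0 : W₁ᵀ * H = 0 := by
    funext i
    by_contra hi
    have h1 := hL₂ ((W₁ᵀ * H) i)
    rw [eigenvalue_of_row hJ] at h1
    have h2 := le_of_mul_le_mul_right h1 (dotProduct_self_pos_of_ne hi)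
    linarith [h.le i j]
  have hHW : H = W₂ * (W₂ᵀ * H) := by
    calc H = (W₁ * W₁ᵀ + W₂ * W₂ᵀ) * H := by rw [h.completeness hrn, Matrix.one_mul]
      _ = _ := by rw [Matrix.add_mul, Matrix.mul_assoc, hJ0, Matrix.mul_zero, zero_add,
        Matrix.mul_assoc]
  have hT : IsUnit (W₂ᵀ * H).det := by
    refine isUnit_det_of_transpose_mul_self ?_
    have e : (W₂ᵀ * H)ᵀ * (W₂ᵀ * H) = Hᵀ * H := by
      rw [Matrix.transpose_mul, Matrix.transpose_transpose, Matrix.mul_assoc, ← hHW]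
    rwa [e]
  have hz : (W₂ᵀ * H)ᵀ * (W₂ᵀ * G) = 0 := by
    rw [← Matrix.mul_assoc, ← Matrix.transpose_mul, ← hHW, hHG]
  refine hne ?_
  have hT' : IsUnit ((W₂ᵀ * H)ᵀ).det := by rwa [Matrix.det_transpose]
  calc W₂ᵀ * G = ((W₂ᵀ * H)ᵀ)⁻¹ * ((W₂ᵀ * H)ᵀ * (W₂ᵀ * G)) :=
        (Matrix.nonsing_inv_mul_cancel_left _ _ hT').symm
    _ = 0 := by rw [hz, Matrix.mul_zero]

/-- If the range of `V` lies in that of an orthonormal `W`, then `W Wᵀ` fixes `V`. -/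
lemma mul_transpose_mul_of_range_le {W V : Matrix (Fin n) (Fin r) ℝ} (hW : Wᵀ * W = 1)
    (h : LinearMap.range V.mulVecLin ≤ LinearMap.range W.mulVecLin) : W * (Wᵀ * V) = V := by
  apply Matrix.ext_of_mulVec_single
  intro j
  obtain ⟨z, hz⟩ := h ⟨Pi.single j 1, rfl⟩
  simp only [Matrix.mulVecLin_apply] at hz
  rw [← Matrix.mulVec_mulVec, ← Matrix.mulVec_mulVec, ← hz, Matrix.mulVec_mulVec z Wᵀ, hW,
    Matrix.one_mulVec]

variable {B : Matrix (Fin n) (Fin n) ℝ}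
  {V₁ : Matrix (Fin n) (Fin r) ℝ} {V₂ : Matrix (Fin n) (Fin (n - r)) ℝ}
  {X : Matrix (Fin (n - r)) (Fin r) ℝ}

/-- A zero of the quadratic map makes the graph `V₁ + V₂ X` invariant. -/
lemma mul_graph_of_quadMap_eq_zero (hc : V₁ * V₁ᵀ + V₂ * V₂ᵀ = 1)
    (hX : quadMap V₁ V₂ B X = 0) :
    B * (V₁ + V₂ * X) = (V₁ + V₂ * X) * (block V₁ B V₁ + block V₁ B V₂ * X) := by
  have h1 : X * (block V₁ B V₁ + block V₁ B V₂ * X) = block V₂ B V₁ + block V₂ B V₂ * X := by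
    rw [← sub_eq_zero, ← hX, quadMap, Matrix.mul_add, Matrix.mul_assoc]
    abel
  calc B * (V₁ + V₂ * X) = (V₁ * V₁ᵀ + V₂ * V₂ᵀ) * (B * (V₁ + V₂ * X)) := by
        rw [hc, Matrix.one_mul]
    _ = V₁ * (block V₁ B V₁ + block V₁ B V₂ * X) +
        V₂ * (block V₂ B V₁ + block V₂ B V₂ * X) := by
      simp only [block, Matrix.mul_add, Matrix.add_mul, Matrix.mul_assoc]
      abel
    _ = _ := by rw [← h1, Matrix.add_mul, Matrix.mul_assoc]

/-- A zero of the quadratic map makes the orthogonal complement `V₂ - V₁ Xᵀ` of the graph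
invariant, for a symmetric matrix. -/
lemma mul_graph_compl_of_quadMap_eq_zero (hc : V₁ * V₁ᵀ + V₂ * V₂ᵀ = 1) (hB : Bᵀ = B)
    (hX : quadMap V₁ V₂ B X = 0) :
    B * (V₂ - V₁ * Xᵀ) = (V₂ - V₁ * Xᵀ) * (block V₂ B V₂ - block V₂ B V₁ * Xᵀ) := by
  have h1 : Xᵀ * (block V₂ B V₂ - block V₂ B V₁ * Xᵀ) =
      -(block V₁ B V₂ - block V₁ B V₁ * Xᵀ) := by
    have h2 := congrArg Matrix.transpose hX
    simp only [quadMap, Matrix.transpose_add, Matrix.transpose_sub, Matrix.transpose_neg,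
      Matrix.transpose_mul, block_transpose, hB, Matrix.transpose_zero] at h2
    rw [← sub_eq_zero, ← neg_eq_zero, ← h2, Matrix.mul_sub]
    abel
  calc B * (V₂ - V₁ * Xᵀ) = (V₁ * V₁ᵀ + V₂ * V₂ᵀ) * (B * (V₂ - V₁ * Xᵀ)) := by
        rw [hc, Matrix.one_mul]
    _ = V₂ * (block V₂ B V₂ - block V₂ B V₁ * Xᵀ) -
        V₁ * (-(block V₁ B V₂ - block V₁ B V₁ * Xᵀ)) := by
      simp only [block, Matrix.mul_sub, Matrix.add_mul, Matrix.mul_assoc, Matrix.mul_neg]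
      abel
    _ = _ := by rw [← h1, Matrix.sub_mul, Matrix.mul_assoc V₁]

end Invariant

/-! ### Estimates for the perturbed subspace -/

section Estimates

variable {n r : ℕ} {A E : Matrix (Fin n) (Fin n) ℝ}
  {V₁ : Matrix (Fin n) (Fin r) ℝ} {V₂ : Matrix (Fin n) (Fin (n - r)) ℝ}
  {μ₁ : Fin r → ℝ} {μ₂ : Fin (n - r) → ℝ} {X : Matrix (Fin (n - r)) (Fin r) ℝ}

lemma gram_graph (h : IsOrderedEigendecomp A V₁ V₂ μ₁ μ₂) :
    (V₁ + V₂ * X)ᵀ * (V₁ + V₂ * X) = 1 + Xᵀ * X := by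
  have e : (V₁ + V₂ * X)ᵀ * (V₁ + V₂ * X) =
      V₁ᵀ * V₁ + V₁ᵀ * V₂ * X + Xᵀ * (V₂ᵀ * V₁) + Xᵀ * (V₂ᵀ * V₂) * X := by
    simp only [Matrix.transpose_add, Matrix.transpose_mul, Matrix.add_mul, Matrix.mul_add,
      Matrix.mul_assoc]
    abel
  rw [e, h.orth₁, h.orth₂, h.orth₁₂, h.orth₂₁]
  simp

lemma gram_graph_compl (h : IsOrderedEigendecomp A V₁ V₂ μ₁ μ₂) :
    (V₂ - V₁ * Xᵀ)ᵀ * (V₂ - V₁ * Xᵀ) = 1 + Xᵀᵀ * Xᵀ := by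
  have e : (V₂ - V₁ * Xᵀ)ᵀ * (V₂ - V₁ * Xᵀ) =
      V₂ᵀ * V₂ - V₂ᵀ * V₁ * Xᵀ - X * (V₁ᵀ * V₂) + X * (V₁ᵀ * V₁) * Xᵀ := by
    simp only [Matrix.transpose_sub, Matrix.transpose_mul, Matrix.sub_mul, Matrix.mul_sub,
      Matrix.mul_assoc, Matrix.transpose_transpose]
    abel
  rw [e, h.orth₁, h.orth₂, h.orth₁₂, h.orth₂₁]
  simp

lemma graph_compl_transpose_mul_graph (h : IsOrderedEigendecomp A V₁ V₂ μ₁ μ₂) :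
    (V₂ - V₁ * Xᵀ)ᵀ * (V₁ + V₂ * X) = 0 := by
  have e : (V₂ - V₁ * Xᵀ)ᵀ * (V₁ + V₂ * X) =
      V₂ᵀ * V₁ + V₂ᵀ * V₂ * X - X * (V₁ᵀ * V₁) - X * (V₁ᵀ * V₂) * X := by
    simp only [Matrix.transpose_sub, Matrix.transpose_mul, Matrix.sub_mul, Matrix.mul_add,
      Matrix.mul_assoc, Matrix.transpose_transpose]
    abel
  rw [e, h.orth₁, h.orth₂, h.orth₁₂, h.orth₂₁]
  simp

lemma le_dotProduct_diagonal {m : ℕ} {μ : Fin m → ℝ} {c : ℝ} (h : ∀ i, c ≤ μ i)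
    (x : Fin m → ℝ) : c * (x ⬝ᵥ x) ≤ x ⬝ᵥ (Matrix.diagonal μ *ᵥ x) := by
  simp only [dotProduct, Matrix.mulVec_diagonal, Finset.mul_sum]
  exact Finset.sum_le_sum fun i _ => by nlinarith [h i, mul_self_nonneg (x i)]

lemma dotProduct_diagonal_le {m : ℕ} {μ : Fin m → ℝ} {c : ℝ} (h : ∀ i, μ i ≤ c)
    (x : Fin m → ℝ) : x ⬝ᵥ (Matrix.diagonal μ *ᵥ x) ≤ c * (x ⬝ᵥ x) := by
  simp only [dotProduct, Matrix.mulVec_diagonal, Finset.mul_sum]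
  exact Finset.sum_le_sum fun i _ => by nlinarith [h i, mul_self_nonneg (x i)]

/-- Any basis of the dominant subspace of the perturbed matrix is a basis of the graph of `X`, for
a zero `X` of the quadratic map that is small enough to keep the two parts of the spectrum
apart. -/
lemma IsDominantBasis.eq_graph_mul (h : IsOrderedEigendecomp A V₁ V₂ μ₁ μ₂) (hrn : r < n)
    (hE : Eᵀ = E) (hX : quadMap V₁ V₂ (A + E) X = 0) {a b : ℝ}
    (ha : ∀ i, a ≤ μ₁ i) (hb : ∀ j, μ₂ j ≤ b)
    (hab : b + (norm2 E + norm2 E * norm2 X) < a - (norm2 E + norm2 E * norm2 X))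
    {W : Matrix (Fin n) (Fin r) ℝ} (hW : IsDominantBasis (A + E) W) :
    W = (V₁ + V₂ * X) * (V₁ᵀ * W) := by
  obtain ⟨-, W₁, W₂, ν₁, ν₂, hd, hrange⟩ := hW
  have hc := h.completeness hrn
  have hB : (A + E)ᵀ = A + E := by rw [Matrix.transpose_add, h.transpose_eq, hE]
  have h11 : block V₁ (A + E) V₁ = Matrix.diagonal μ₁ + block V₁ E V₁ := by
    rw [block_add, h.block₁₁]
  have h22 : block V₂ (A + E) V₂ = Matrix.diagonal μ₂ + block V₂ E V₂ := by
    rw [block_add, h.block₂₂]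
  have h12 : block V₁ (A + E) V₂ = block V₁ E V₂ := by rw [block_add, h.block₁₂, zero_add]
  have h21 : block V₂ (A + E) V₁ = block V₂ E V₁ := by rw [block_add, h.block₂₁, zero_add]
  have hG := mul_graph_of_quadMap_eq_zero hc hX
  have hH := mul_graph_compl_of_quadMap_eq_zero hc hB hX
  rw [h11, h12] at hG
  rw [h22, h21] at hH
  have hzero : W₂ᵀ * (V₁ + V₂ * X) = 0 := by
    refine hd.transpose_mul_eq_zero hrn hG hH (graph_compl_transpose_mul_graph h) ?_ hab
      (fun x => ?_) (fun y => ?_)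
    · rw [gram_graph_compl h]; exact isUnit_det_one_add_transpose_mul_self _
    · have h1 := le_dotProduct_diagonal ha x
      have h2 := (abs_le.1 (abs_dotProduct_mulVec_le (block V₁ E V₁ + block V₁ E V₂ * X) x)).1
      have h3 : norm2 (block V₁ E V₁ + block V₁ E V₂ * X) ≤ norm2 E + norm2 E * norm2 X :=
        (norm2_add_le _ _).trans (add_le_add (norm2_block_le h.orth₁ h.orth₁ E)
          ((norm2_mul_le _ _).trans (mul_le_mul_of_nonneg_right
            (norm2_block_le h.orth₁ h.orth₂ E) (norm2_nonneg X))))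
      have h4 := mul_le_mul_of_nonneg_right h3 (dotProduct_self_nonneg' x)
      rw [add_assoc, Matrix.add_mulVec, dotProduct_add]
      linarith
    · have h1 := dotProduct_diagonal_le hb y
      have h2 := (abs_le.1 (abs_dotProduct_mulVec_le (block V₂ E V₂ - block V₂ E V₁ * Xᵀ) y)).2
      have h3 : norm2 (block V₂ E V₂ - block V₂ E V₁ * Xᵀ) ≤ norm2 E + norm2 E * norm2 X := by
        rw [← norm2_transpose X]
        exact (norm2_sub_le _ _).trans (add_le_add (norm2_block_le h.orth₂ h.orth₂ E)
          ((norm2_mul_le _ _).trans (mul_le_mul_of_nonneg_right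
            (norm2_block_le h.orth₂ h.orth₁ E) (norm2_nonneg _))))
      have h4 := mul_le_mul_of_nonneg_right h3 (dotProduct_self_nonneg' y)
      rw [add_sub_assoc, Matrix.add_mulVec, dotProduct_add]
      linarith
  have hGW : W₁ * (W₁ᵀ * (V₁ + V₂ * X)) = V₁ + V₂ * X := by
    calc W₁ * (W₁ᵀ * (V₁ + V₂ * X))
        = (W₁ * W₁ᵀ + W₂ * W₂ᵀ) * (V₁ + V₂ * X) := by
          rw [Matrix.add_mul, Matrix.mul_assoc W₂, hzero, Matrix.mul_zero, add_zero,
            Matrix.mul_assoc W₁]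
      _ = _ := by rw [hd.completeness hrn, Matrix.one_mul]
  have hT : IsUnit (W₁ᵀ * (V₁ + V₂ * X)).det := by
    refine isUnit_det_of_transpose_mul_self ?_
    have e : (W₁ᵀ * (V₁ + V₂ * X))ᵀ * (W₁ᵀ * (V₁ + V₂ * X)) = 1 + Xᵀ * X := by
      rw [← gram_graph h, Matrix.transpose_mul, Matrix.transpose_transpose, Matrix.mul_assoc, hGW]
    rw [e]
    exact isUnit_det_one_add_transpose_mul_self X
  have hW1 : W = (V₁ + V₂ * X) * ((W₁ᵀ * (V₁ + V₂ * X))⁻¹ * (W₁ᵀ * W)) := by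
    calc W = W₁ * (W₁ᵀ * W) := (mul_transpose_mul_of_range_le hd.orth₁ hrange.le).symm
      _ = W₁ * ((W₁ᵀ * (V₁ + V₂ * X)) *
          ((W₁ᵀ * (V₁ + V₂ * X))⁻¹ * (W₁ᵀ * W))) := by
        rw [Matrix.mul_nonsing_inv_cancel_left _ _ hT]
      _ = _ := by rw [← Matrix.mul_assoc W₁, hGW]
  have hVG : V₁ᵀ * (V₁ + V₂ * X) = 1 := by
    rw [Matrix.mul_add, h.orth₁, ← Matrix.mul_assoc, h.orth₁₂, Matrix.zero_mul, add_zero]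
  have hVW : V₁ᵀ * W = (W₁ᵀ * (V₁ + V₂ * X))⁻¹ * (W₁ᵀ * W) := by
    conv_lhs => rw [hW1, ← Matrix.mul_assoc, hVG, Matrix.one_mul]
  rw [hVW]
  exact hW1

/-- The aligned basis is `(V₁ + V₂ X) P` with `P = (1 + Xᵀ X)^(-1/2)`, so its distance to `V₁`
splits into `V₁ (P - 1)` and `V₂ X P`. -/
lemma normTwoInf_procrustes_sub_le (h : IsOrderedEigendecomp A V₁ V₂ μ₁ μ₂)
    {W : Matrix (Fin n) (Fin r) ℝ} (hW : Wᵀ * W = 1)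
    (hWG : W = (V₁ + V₂ * X) * (V₁ᵀ * W)) {U : Matrix (Fin r) (Fin r) ℝ}
    (hU : IsProcrustesSolution W V₁ U) :
    normTwoInf (W * U - V₁) ≤ normTwoInf V₁ * norm2 X ^ 2 + normTwoInf (V₂ * X) := by
  have hM : (V₁ᵀ * W)ᵀ * (1 + Xᵀ * X) * (V₁ᵀ * W) = 1 := by
    calc (V₁ᵀ * W)ᵀ * (1 + Xᵀ * X) * (V₁ᵀ * W)
        = ((V₁ + V₂ * X) * (V₁ᵀ * W))ᵀ * ((V₁ + V₂ * X) * (V₁ᵀ * W)) := by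
          rw [← gram_graph h, Matrix.transpose_mul (V₁ + V₂ * X)]
          simp only [Matrix.mul_assoc]
      _ = 1 := by rw [← hWG, hW]
  have hdet : IsUnit (V₁ᵀ * W).det := by
    have h1 := congrArg Matrix.det hM
    rw [Matrix.det_mul, Matrix.det_one] at h1
    exact IsUnit.of_mul_eq_one_right _ h1
  have hP := hU.posSemidef hW h.orth₁ hdet
  set P := V₁ᵀ * W * U with hPdef
  have hPt : Pᵀ = P := by simpa [Matrix.IsHermitian] using hP.isHermitian
  have hUU : Uᵀ * U = 1 := (Matrix.mem_orthogonalGroup_iff' (Fin r) ℝ).1 hU.1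
  have hPP : P * (1 + Xᵀ * X) * P = 1 := by
    calc P * (1 + Xᵀ * X) * P = Pᵀ * (1 + Xᵀ * X) * P := by rw [hPt]
      _ = Uᵀ * ((V₁ᵀ * W)ᵀ * (1 + Xᵀ * X) * (V₁ᵀ * W)) * U := by
        rw [hPdef, Matrix.transpose_mul _ U]
        simp only [Matrix.mul_assoc]
      _ = 1 := by rw [hM, Matrix.mul_one, hUU]
  obtain ⟨hP1, hP2⟩ := norm2_le_of_posSemidef_mul_mul_eq_one hP hPP
  have e : W * U - V₁ = V₁ * (P - 1) + V₂ * X * P := by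
    have h1 : W * U = (V₁ + V₂ * X) * P := by
      rw [hPdef, ← Matrix.mul_assoc, ← hWG]
    rw [h1, Matrix.mul_sub, Matrix.add_mul, Matrix.mul_one]
    abel
  rw [e]
  refine (normTwoInf_add_le _ _).trans (add_le_add ?_ ?_)
  · exact (normTwoInf_mul_le _ _).trans (mul_le_mul_of_nonneg_left hP2 (normTwoInf_nonneg _))
  · exact (normTwoInf_mul_le _ _).trans (mul_le_of_le_one_right (normTwoInf_nonneg _) hP1)

/-- Multiplied by `V₂`, the equation `F(X) = 0` is a Sylvester equation for `Y = V₂ X` whose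
right-hand side involves `Y` only through small factors. -/
lemma sepOn_mul_normTwoInf_le (h : IsOrderedEigendecomp A V₁ V₂ μ₁ μ₂)
    (hX : quadMap V₁ V₂ (A + E) X = 0) :
    sepOn normTwoInf V₂ (Matrix.diagonal μ₁) (V₂ * Matrix.diagonal μ₂ * V₂ᵀ) *
        normTwoInf (V₂ * X) ≤
      normTwoInf (V₂ * block V₂ E V₁) + normTwoInf (V₂ * block V₂ E V₂ * V₂ᵀ * (V₂ * X)) +
        normTwoInf (V₂ * X) * (norm2 E + norm2 E * norm2 X) := by
  have h1 := sepOn_mul_le (N := normTwoInf) normTwoInf_nonneg normTwoInf_smul V₂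
    (Matrix.diagonal μ₁) (V₂ * Matrix.diagonal μ₂ * V₂ᵀ) X
  have hproj : ∀ D : Matrix (Fin (n - r)) (Fin (n - r)) ℝ,
      V₂ * D * V₂ᵀ * (V₂ * X) = V₂ * (D * X) := fun D => by
    rw [Matrix.mul_assoc (V₂ * D), ← Matrix.mul_assoc V₂ᵀ, h.orth₂, Matrix.one_mul,
      Matrix.mul_assoc]
  have e : V₂ * X * Matrix.diagonal μ₁ - V₂ * Matrix.diagonal μ₂ * V₂ᵀ * (V₂ * X) =
      V₂ * block V₂ E V₁ + V₂ * block V₂ E V₂ * V₂ᵀ * (V₂ * X) -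
        V₂ * X * (block V₁ E V₁ + block V₁ E V₂ * X) := by
    have h2 : X * Matrix.diagonal μ₁ - Matrix.diagonal μ₂ * X =
        block V₂ E V₁ + block V₂ E V₂ * X - X * (block V₁ E V₁ + block V₁ E V₂ * X) := by
      rw [← sub_eq_zero, ← hX, quadMap, block_add, block_add, block_add, block_add, h.block₁₁,
        h.block₁₂, h.block₂₁, h.block₂₂]
      simp only [Matrix.mul_add, Matrix.add_mul, zero_add, Matrix.mul_assoc]
      abel
    rw [hproj, hproj, Matrix.mul_assoc V₂ X, Matrix.mul_assoc V₂ X, ← Matrix.mul_sub, h2,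
      Matrix.mul_sub, Matrix.mul_add]
  rw [e] at h1
  have h3 : norm2 (block V₁ E V₁ + block V₁ E V₂ * X) ≤ norm2 E + norm2 E * norm2 X :=
    (norm2_add_le _ _).trans (add_le_add (norm2_block_le h.orth₁ h.orth₁ E)
      ((norm2_mul_le _ _).trans (mul_le_mul_of_nonneg_right
        (norm2_block_le h.orth₁ h.orth₂ E) (norm2_nonneg X))))
  refine h1.trans ((normTwoInf_sub_le _ _).trans (add_le_add (normTwoInf_add_le _ _) ?_))
  exact (normTwoInf_mul_le _ _).trans (mul_le_mul_of_nonneg_left h3 (normTwoInf_nonneg _))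

end Estimates

end RowPert

theorem lemma3p5 (n r : ℕ) (hr : 0 < r) (hrn : r < n)
    (A : Matrix (Fin n) (Fin n) ℝ) (hA : A.IsSymm)
    (V₁ : Matrix (Fin n) (Fin r) ℝ) (V₂ : Matrix (Fin n) (Fin (n - r)) ℝ)
    (μ₁ : Fin r → ℝ) (μ₂ : Fin (n - r) → ℝ)
    (hdec : IsOrderedEigendecomp A V₁ V₂ μ₁ μ₂) (hsplit : ∀ i j, μ₂ j < μ₁ i)
    (E : Matrix (Fin n) (Fin n) ℝ) (hE : E.IsSymm)
    (hEgap : norm2 E ≤ gap V₂ μ₁ μ₂ / 5) :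
    Function.Bijective (sylvester V₁ V₂ (A + E)) ∧
    ∃ Xhat : Matrix (Fin (n - r)) (Fin r) ℝ,
      Filter.Tendsto (newtonSeq V₁ V₂ (A + E)) Filter.atTop (𝓝 Xhat) ∧
      quadMap V₁ V₂ (A + E) Xhat = 0 ∧
      norm2 Xhat ≤ 4 * norm2 (block V₂ E V₁) /
        sep norm2 (Matrix.diagonal μ₁) (Matrix.diagonal μ₂) ∧
      ∀ (V₁hat : Matrix (Fin n) (Fin r) ℝ) (U : Matrix (Fin r) (Fin r) ℝ),
        IsDominantBasis (A + E) V₁hat → IsProcrustesSolution V₁hat V₁ U →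
        normTwoInf (V₁hat * U - V₁) ≤
          8 * normTwoInf V₁ * (norm2 (block V₂ E V₁) /
              sep norm2 (Matrix.diagonal μ₁) (Matrix.diagonal μ₂)) ^ 2 +
          2 * ((normTwoInf (V₂ * block V₂ E V₁) +
              normTwoInf (V₂ * block V₂ E V₂ * V₂ᵀ * (V₂ * Xhat))) / gap V₂ μ₁ μ₂) := by
  have hl : r - 1 < r := by omega
  have hm : 0 < n - r := by omega
  have ha : ∀ i, μ₁ ⟨r - 1, hl⟩ ≤ μ₁ i := fun i =>
    hdec.antitone₁ (Fin.le_def.2 (Nat.le_sub_one_of_lt i.2))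
  have hb : ∀ j, μ₂ j ≤ μ₂ ⟨0, hm⟩ := fun j => hdec.antitone₂ (Fin.le_def.2 (Nat.zero_le _))
  have hspec := sub_pos.2 (hsplit ⟨r - 1, hl⟩ ⟨0, hm⟩)
  have hδ : 0 < sep norm2 (Matrix.diagonal μ₁) (Matrix.diagonal μ₂) :=
    sep_norm2_diagonal_pos hm hr hspec fun i j => sub_le_sub (ha j) (hb i)
  have hδ' := sep_norm2_diagonal_le μ₁ μ₂ ⟨0, hm⟩ ⟨r - 1, hl⟩
  rw [abs_of_pos hspec] at hδ'
  have hgδ : gap V₂ μ₁ μ₂ ≤ sep norm2 (Matrix.diagonal μ₁) (Matrix.diagonal μ₂) := min_le_left _ _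
  have hgs : gap V₂ μ₁ μ₂ ≤
      sepOn normTwoInf V₂ (Matrix.diagonal μ₁) (V₂ * Matrix.diagonal μ₂ * V₂ᵀ) := min_le_right _ _
  have hlow := fun Z => hdec.sylvester_lower (E := E) Z
  have hε := norm2_nonneg E
  have hγε := norm2_block_le hdec.orth₂ hdec.orth₁ E
  have hγ := norm2_nonneg (block V₂ E V₁)
  have hB21 : block V₂ (A + E) V₁ = block V₂ E V₁ := by rw [block_add, hdec.block₂₁, zero_add]
  have hB12 : norm2 (block V₁ (A + E) V₂) = norm2 (block V₂ E V₁) := by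
    rw [block_add, hdec.block₁₂, zero_add, ← norm2_transpose, block_transpose, hE.eq]
  set δ := sep norm2 (Matrix.diagonal μ₁) (Matrix.diagonal μ₂) with hδdef
  set g := gap V₂ μ₁ μ₂ with hg
  set ε := norm2 E with hεdef
  set γ := norm2 (block V₂ E V₁) with hγdef
  have hσ : 0 < δ - 2 * ε := by linarith
  -- The ball of radius `2 γ / δ` is already invariant under the iteration; this radius, and not
  -- `4 γ / δ`, yields the constant `8` below.
  have hρδ : 2 * (γ / δ) * δ = 2 * γ := by field_simp
  have hρ0 : 0 ≤ γ / δ := by positivity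
  have hρ : γ / δ ≤ 1 / 5 := by
    rw [div_le_iff₀ hδ]; linarith
  obtain ⟨X, hlim, hXρ, hX⟩ := newtonSeq_tendsto (ρ := 2 * (γ / δ)) hσ (by positivity) hlow
    (by rw [hB21]) hB12.le (by nlinarith) (by nlinarith)
  refine ⟨sylvester_bijective hσ hlow, X, hlim, hX, ?_, fun W U hW hU => ?_⟩
  · rw [mul_div_assoc]; linarith
  have hX0 := norm2_nonneg X
  have hsmall : ε + ε * norm2 X ≤ 7 / 5 * ε := by nlinarith
  have hWG := hW.eq_graph_mul hdec hrn hE.eq hX ha hb (by linarith)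
  refine (normTwoInf_procrustes_sub_le hdec hW.1 hWG hU).trans (add_le_add ?_ ?_)
  · have h1 : norm2 X ^ 2 ≤ 8 * (γ / δ) ^ 2 := by nlinarith
    linarith [mul_le_mul_of_nonneg_left h1 (normTwoInf_nonneg V₁)]
  · have hY := sepOn_mul_normTwoInf_le hdec hX
    rw [← hεdef] at hY
    have hY0 := normTwoInf_nonneg (V₂ * X)
    have hg0 : 0 ≤ g := by linarith
    rcases hg0.eq_or_lt with hz | hpos
    · -- If `g = 0`, then `E = 0` and both sides vanish.
      have hγ0 : γ = 0 := by linarith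
      have hXz : X = 0 := norm2_eq_zero.1 (le_antisymm (by simpa [hγ0] using hXρ) hX0)
      rw [← hz, hXz]
      simp [normTwoInf]
    · rw [← mul_div_assoc, le_div_iff₀ hpos]
      have h1 := mul_le_mul_of_nonneg_right hgs hY0
      have h2 := mul_le_mul_of_nonneg_left hsmall hY0
      nlinarith
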